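/- **Setting.** Polarized SILL is a language of functional terms and session-typed processes. A *domain* is a pointed directed-complete partial order; continuous means Scott continuous; $D_\bot$ is the lift of $D$, with inclusion $\mathrm{up}:D\to D_\bot$ and $\mathrm{down}:D_\bot\to D$, $\mathrm{down}(\bot)=\bot$, $\mathrm{down}(\mathrm{up}\,x)=x$. A closed session type $A$ denotes two domains $[\![A]\!]^+$ and $[\![A]\!]^-$ (the communications from provider to client and from client to provider). A process $\Psi;\Delta\vdash P::c:C$ (using the channels $\Delta$, providing $c$, with functional variables $\Psi$) denotes a continuous function $$[\![P]\!]:[\![\Psi]\!]\to\bigl[\,[\![\Delta]\!]^+\times[\![C]\!]^-\to[\![\Delta]\!]^-\times[\![C]\!]^+\,\bigr],$$ and a term $\Psi\Vdash M:\tau$ denotes a continuous function $[\![\Psi]\!]\to[\![\tau]\!]$. Contexts denote products, and the type of quoted processes that use $\Delta$ and provide $c:C$ denotes $\bigl[\,[\![\Delta]\!]^+\times[\![C]\!]^-\to[\![\Delta]\!]^-\times[\![C]\!]^+\,\bigr]_\bot$. Types: $[\![\oplus\{l:A_l\}]\!]^+=\bigoplus_l\,([\![A_l]\!]^+)_\bot$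 (coalesced sum, with elements $\bot$ and $(l,\mathrm{up}\,x)$), $[\![\oplus\{l:A_l\}]\!]^-=\prod_l[\![A_l]\!]^-$, and $[\![\rho\beta.A]\!]^{\pm}$ is the canonical fixed point of the locally continuous functor $[\![A]\!]^{\pm}$ of $\beta$ on domains and strict continuous functions, with mutually inverse isomorphisms $\mathrm{Fold}^\pm,\mathrm{Unfold}^\pm$. Processes and terms (with environment $u$): - the forwarder $b\leftarrow a$ maps $(a^+,b^-)$ to $(a^-,b^+)=(b^-,a^+)$; - a composition $a\leftarrow P;\,Q$ denotes the trace (the least-fixed-point feedback) of $[\![P]\!]u\times[\![Q]\!]u$ over $a^-\times a^+$; - quoting a process denotes $\mathrm{up}\circ[\![P]\!]$, spawning a quoted process $M$ denotes $\mathrm{down}\circ[\![M]\!]$, and $\mathsf{fix}\,F.M$ denotes the parametrized least fixed point of $[\![M]\!]$; - sending label $k$ on the provided channel $a$ and continuing as $P$ maps $(\delta^+,(a_l^-)_l)$ to $(\delta^-,(k,\mathrm{up}\,a_k^+))$, where $[\![P]\!]u(\delta^+,a_k^-)=(\delta^-,a_k^+)$; - $\mathsf{case}\ a\ \{l\Rightarrow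 P_l\}$ outputs $\bot$ if $a^+=\bot$; if $a^+=(k,\mathrm{up}\,x)$ it outputs what $[\![P_k]\!]u$ outputs on input $x$ on $a^+$, with the output on $a^-$ placed in component $k$ of $\prod_l[\![A_l]\!]^-$ and $\bot$ in the other components; - sending or receiving an unfold message composes $[\![P]\!]u$ on the relevant channel with $\mathrm{Fold}$ on outputs and $\mathrm{Unfold}$ on inputs. **Bit flipping.** Let $\mathsf{bits}=\rho\beta.\oplus\{0:\beta,\,1:\beta\}$, write $\tilde 0=1$, $\tilde 1=0$, and let $\mathsf{flip}$ be the closed term of quoted-process type $$\mathsf{flip}=\mathsf{fix}\,F.\ \bigl(f\leftarrow\{\mathsf{send}\ f\ \mathsf{unfold};\ \mathsf{unfold}\leftarrow\mathsf{recv}\ b;\ \mathsf{case}\ b\ \{l\Rightarrow f.\tilde l;\ f\leftarrow\{F\}\leftarrow b\}_{l\in\{0,1\}}\}\leftarrow b\bigr),$$ which uses $b:\mathsf{bits}$ and provides $f:\mathsf{bits}$. **Theorem.** Flipping twice is denotationally equal to forwarding: $$[\![\,\cdot\,;a:\mathsf{bits}\vdash(t\leftarrow\{\mathsf{flip}\}\leftarrow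 a;\ b\leftarrow\{\mathsf{flip}\}\leftarrow t)::b:\mathsf{bits}]\!]=[\![\,\cdot\,;a:\mathsf{bits}\vdash b\leftarrow a::b:\mathsf{bits}]\!].$$ Moreover (equivalently), for all $a\in[\![\mathsf{bits}]\!]^+$, $$[\![\,\cdot\,;a:\mathsf{bits}\vdash(t\leftarrow\{\mathsf{flip}\}\leftarrow a;\ b\leftarrow\{\mathsf{flip}\}\leftarrow t)::b:\mathsf{bits}]\!]\,\bot\,(a,\bot)=(\bot,a),$$ that is, the composite acts as the identity on $[\![\mathsf{bits}]\!]^+$. -/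

import Mathlib

open CategoryTheory

namespace SILL

/-! ### Pointed dcpos and Scott continuous functions -/

/-- A partial order (possibly without a least element) in which every nonempty directed set has a
least upper bound. -/
class DirComplete (P : Type) [PartialOrder P] : Prop where
  exists_isLUB : ∀ d : Set P, d.Nonempty → DirectedOn (· ≤ ·) d → ∃ a, IsLUB d a

instance (priority := 50) DirComplete.ofCompletePartialOrder (P : Type) [CompletePartialOrder P] :
    DirComplete P :=
  ⟨fun _ _ hd => ⟨_, hd.isLUB_sSup⟩⟩

open Classical in
/-- A directed-complete partial order with a least element is a `CompletePartialOrder`. -/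
@[reducible]
noncomputable def DirComplete.toCompletePartialOrder (P : Type) [PartialOrder P] [OrderBot P]
    [DirComplete P] : CompletePartialOrder P where
  sSup d := if h : d.Nonempty ∧ DirectedOn (· ≤ ·) d then
    (DirComplete.exists_isLUB d h.1 h.2).choose else ⊥
  lubOfDirected d hd := by
    by_cases hne : d.Nonempty
    · rw [dif_pos ⟨hne, hd⟩]
      exact (DirComplete.exists_isLUB d hne hd).choose_spec
    · rw [dif_neg (fun h => hne h.1), Set.not_nonempty_iff_eq_empty.1 hne]
      exact isLUB_empty

instance prodCompletePartialOrder {X Y : Type} [CompletePartialOrder X] [CompletePartialOrder Y] :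
    CompletePartialOrder (X × Y) where
  sSup d := (sSup (Prod.fst '' d), sSup (Prod.snd '' d))
  lubOfDirected _ hd := isLUB_prod.2
    ⟨(DirectedOn.fst hd).isLUB_sSup, (DirectedOn.snd hd).isLUB_sSup⟩

instance piCompletePartialOrder {ι : Type} {D : ι → Type} [∀ i, CompletePartialOrder (D i)] :
    CompletePartialOrder (∀ i, D i) where
  sSup d := fun i => sSup ((fun f => f i) '' d)
  lubOfDirected _ hd := isLUB_pi.2 fun i =>
    (hd.mono_comp (g := fun f : (∀ i, D i) => f i) (fun _ _ h => h i)).isLUB_sSup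

/-- Scott continuous functions between pointed dcpos. -/
structure ScottHom (X Y : Type) [CompletePartialOrder X] [CompletePartialOrder Y] where
  toFun : X → Y
  scott : ScottContinuous toFun

namespace ScottHom

variable {E X Y Z : Type} [CompletePartialOrder E] [CompletePartialOrder X]
  [CompletePartialOrder Y] [CompletePartialOrder Z]

instance : FunLike (ScottHom X Y) X Y where
  coe := toFun
  coe_injective f g h := by cases f; cases g; congr

@[ext] theorem ext {f g : ScottHom X Y} (h : ∀ x, f x = g x) : f = g := DFunLike.ext _ _ h

@[simp] theorem mk_apply (f : X → Y) (hf : ScottContinuous f) (x : X) :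
    (⟨f, hf⟩ : ScottHom X Y) x = f x := rfl

@[fun_prop] theorem continuous (f : ScottHom X Y) : ScottContinuous f := f.scott

instance : PartialOrder (ScottHom X Y) := PartialOrder.lift (fun f x => f x) DFunLike.coe_injective

theorem le_def {f g : ScottHom X Y} : f ≤ g ↔ ∀ x, f x ≤ g x := Iff.rfl

instance : OrderBot (ScottHom X Y) where
  bot := ⟨fun _ => ⊥, ScottContinuous.const ⊥⟩
  bot_le _ _ := bot_le

@[simp] theorem bot_apply (x : X) : (⊥ : ScottHom X Y) x = ⊥ := rfl

theorem isLUB_of_apply {S : Set (ScottHom X Y)} {g : ScottHom X Y}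
    (h : ∀ x, IsLUB ((fun f : ScottHom X Y => f x) '' S) (g x)) : IsLUB S g :=
  ⟨fun f hf x => (h x).1 ⟨f, hf, rfl⟩, fun k hk x => (h x).2 (by
    rintro _ ⟨f, hf, rfl⟩; exact hk hf x)⟩

theorem directedOn_apply {S : Set (ScottHom X Y)} (hS : DirectedOn (· ≤ ·) S) (x : X) :
    DirectedOn (· ≤ ·) ((fun f : ScottHom X Y => f x) '' S) :=
  hS.mono_comp (g := fun f : ScottHom X Y => f x) (fun _ _ h => h x)

/-- The pointwise least upper bound of a directed set of Scott continuous functions. -/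
noncomputable def dirSup (S : Set (ScottHom X Y)) (hS : DirectedOn (· ≤ ·) S) : ScottHom X Y where
  toFun x := sSup ((fun f : ScottHom X Y => f x) '' S)
  scott e hne hdir a ha := by
    have key : ∀ x, IsLUB ((fun f : ScottHom X Y => f x) '' S)
        (sSup ((fun f : ScottHom X Y => f x) '' S)) :=
      fun x => (directedOn_apply hS x).isLUB_sSup
    refine ⟨?_, fun b hb => (key a).2 ?_⟩
    · rintro _ ⟨x, hx, rfl⟩
      refine (key x).2 ?_
      rintro _ ⟨f, hf, rfl⟩
      exact (f.scott.monotone (ha.1 hx)).trans ((key a).1 ⟨f, hf, rfl⟩)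
    · rintro _ ⟨f, hf, rfl⟩
      refine (f.scott hne hdir ha).2 ?_
      rintro _ ⟨x, hx, rfl⟩
      exact ((key x).1 ⟨f, hf, rfl⟩).trans (hb ⟨x, hx, rfl⟩)

theorem isLUB_dirSup (S : Set (ScottHom X Y)) (hS : DirectedOn (· ≤ ·) S) :
    IsLUB S (dirSup S hS) :=
  isLUB_of_apply fun x => (directedOn_apply hS x).isLUB_sSup

instance : DirComplete (ScottHom X Y) := ⟨fun S _ hS => ⟨_, isLUB_dirSup S hS⟩⟩

noncomputable instance : CompletePartialOrder (ScottHom X Y) :=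
  DirComplete.toCompletePartialOrder _

theorem isLUB_apply {S : Set (ScottHom X Y)} {g : ScottHom X Y} (hS : DirectedOn (· ≤ ·) S)
    (h : IsLUB S g) (x : X) : IsLUB ((fun f : ScottHom X Y => f x) '' S) (g x) := by
  rw [h.unique (isLUB_dirSup S hS)]
  exact (directedOn_apply hS x).isLUB_sSup

@[fun_prop] theorem continuous_apply {f : E → ScottHom X Y} {g : E → X} (hf : ScottContinuous f)
    (hg : ScottContinuous g) : ScottContinuous fun e => f e (g e) := by
  have : ScottContinuous fun p : ScottHom X Y × X => p.1 p.2 :=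
    .fromProd (fun f => f.scott) fun x S _ hS _ ha => isLUB_apply hS ha x
  exact (hf.prodMk hg).comp this

theorem continuous_of_apply {f : E → ScottHom X Y} (h : ∀ x, ScottContinuous fun e => f e x) :
    ScottContinuous f := fun d hne hd a ha => isLUB_of_apply fun x => by
  rw [Set.image_image]; exact h x hne hd ha

/-- Composition. -/
def comp (g : ScottHom Y Z) (f : ScottHom X Y) : ScottHom X Z := ⟨fun x => g (f x), by fun_prop⟩

/-- Product of two Scott continuous functions. -/
def prodMap {X' Y' : Type} [CompletePartialOrder X'] [CompletePartialOrder Y'] (f : ScottHom X Y)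
    (g : ScottHom X' Y') : ScottHom (X × X') (Y × Y') :=
  ⟨fun p => (f p.1, g p.2), by fun_prop⟩

end ScottHom

@[fun_prop] theorem _root_.ScottContinuous.pi {E ι : Type} {D : ι → Type} [Preorder E]
    [∀ i, Preorder (D i)] {f : E → ∀ i, D i} (h : ∀ i, ScottContinuous fun e => f e i) :
    ScottContinuous f := fun d hne hd a ha => isLUB_pi.2 fun i => by
  rw [Set.image_image]; exact h i hne hd ha

@[fun_prop] theorem _root_.ScottContinuous.piApply {ι : Type} {D : ι → Type} 
    [∀ i, Preorder (D i)] (i : ι) :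
    ScottContinuous fun f : (∀ i, D i) => f i := fun _ _ _ _ ha => isLUB_pi.1 ha i

theorem _root_.ScottContinuous.iSup_chain {E X : Type} [Preorder E] [CompletePartialOrder X]
    {g : ℕ → E → X} (hg : ∀ n, ScottContinuous (g n)) (hm : ∀ e, Monotone fun n => g n e) :
    ScottContinuous fun e => ⨆ n, g n e := by
  have key : ∀ e, IsLUB (Set.range fun n => g n e) (⨆ n, g n e) := fun e =>
    (directedOn_range.1 (hm e).directed_le.directedOn_range).directedOn_range.isLUB_sSup
  intro d hne hd a ha
  refine ⟨?_, fun b hb => (key a).2 ?_⟩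
  · rintro _ ⟨x, hx, rfl⟩
    refine (key x).2 ?_
    rintro _ ⟨n, rfl⟩
    exact ((hg n).monotone (ha.1 hx)).trans ((key a).1 ⟨n, rfl⟩)
  · rintro _ ⟨n, rfl⟩
    refine (hg n hne hd ha).2 ?_
    rintro _ ⟨x, hx, rfl⟩
    exact ((key x).1 ⟨n, rfl⟩).trans (hb ⟨x, hx, rfl⟩)

/-! ### Fixed points and the trace operator -/

section Fix

variable {A B D X Y : Type} [CompletePartialOrder A] [CompletePartialOrder B]
  [CompletePartialOrder D] [CompletePartialOrder X] [CompletePartialOrder Y]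

theorem ScottHom.continuous_iterate (n : ℕ) :
    ScottContinuous fun f : ScottHom D D => f^[n] ⊥ := by
  induction n with
  | zero => exact ScottContinuous.const ⊥
  | succ n ih =>
    simp only [Function.iterate_succ_apply']
    exact ScottHom.continuous_apply ScottContinuous.id ih

theorem ScottHom.monotone_iterate (f : ScottHom D D) : Monotone fun n => f^[n] ⊥ :=
  f.scott.monotone.monotone_iterate_of_le_map bot_le

/-- The continuous least fixed point operator `fix : [D → D] → D`, `fix f = ⨆ n, fⁿ(⊥)`. -/
noncomputable def fix : ScottHom (ScottHom D D) D :=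
  ⟨fun f => ⨆ n : ℕ, f^[n] ⊥,
    .iSup_chain ScottHom.continuous_iterate ScottHom.monotone_iterate⟩

/-- The section `f(a, -)`. -/
def ScottHom.curry (f : ScottHom (A × X) Y) : ScottHom A (ScottHom X Y) :=
  ⟨fun a => ⟨fun x => f (a, x), by fun_prop⟩,
    ScottHom.continuous_of_apply fun x => by simp only [ScottHom.mk_apply]; fun_prop⟩

/-- The parametrized fixed point operator: `dagger f a = fix (fun x => f (a, x))`. -/
noncomputable def dagger (f : ScottHom (A × X) X) : ScottHom A X :=
  ⟨fun a => fix (f.curry a), by fun_prop⟩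

theorem continuous_dagger :
    ScottContinuous (dagger : ScottHom (A × X) X → ScottHom A X) := by
  refine ScottHom.continuous_of_apply fun a => ?_
  have : ScottContinuous fun f : ScottHom (A × X) X => f.curry a :=
    ScottHom.continuous_of_apply fun x =>
      ScottHom.continuous_apply (f := fun f : ScottHom (A × X) X => f) ScottContinuous.id
        (ScottContinuous.fun_const (a, x))
  exact this.comp fix.scott

/-- The trace operator: `trace f = π_B ∘ f ∘ ⟨id, dagger (π_X ∘ f)⟩`. -/
noncomputable def trace (f : ScottHom (A × X) (B × X)) : ScottHom A B :=
  ⟨fun a => (f (a, dagger ⟨fun p => (f p).2, by fun_prop⟩ a)).1, by fun_prop⟩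

theorem continuous_trace :
    ScottContinuous (trace : ScottHom (A × X) (B × X) → ScottHom A B) := by
  refine ScottHom.continuous_of_apply fun a => ?_
  have h : ScottContinuous fun f : ScottHom (A × X) (B × X) =>
      (⟨fun p => (f p).2, by fun_prop⟩ : ScottHom (A × X) X) :=
    ScottHom.continuous_of_apply fun p => by
      simp only [ScottHom.mk_apply]
      exact (ScottHom.continuous_apply ScottContinuous.id (ScottContinuous.fun_const p)).comp
        ScottContinuous.snd
  have h' := ScottHom.continuous_apply (h.comp continuous_dagger) (ScottContinuous.fun_const a)
  exact (ScottHom.continuous_apply ScottContinuous.id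
    ((ScottContinuous.fun_const a).prodMk h')).comp ScottContinuous.fst

end Fix

/-! ### Lifting and sums -/

/-- The lift of `P`: a new least element is adjoined. -/
def Lift (P : Type) : Type := WithBot P

namespace Lift

variable {E P Q Z : Type}

instance [PartialOrder P] : PartialOrder (Lift P) := inferInstanceAs (PartialOrder (WithBot P))
instance [PartialOrder P] : OrderBot (Lift P) := inferInstanceAs (OrderBot (WithBot P))

/-- The inclusion of `P` in its lift. -/
def up (x : P) : Lift P := WithBot.some x

theorem up_le_up [PartialOrder P] {x y : P} : up x ≤ up y ↔ x ≤ y := WithBot.coe_le_coe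

theorem not_up_le_bot [PartialOrder P] (x : P) : ¬ up x ≤ ⊥ := WithBot.not_coe_le_bot x

theorem cases [PartialOrder P] (s : Lift P) : s = ⊥ ∨ ∃ x, s = up x := by
  cases s using WithBot.recBotCoe
  · exact .inl rfl
  · exact .inr ⟨_, rfl⟩

/-- The strict extension of `f`: it maps `⊥` to `⊥` and `up x` to `f x`. -/
def elim [Bot Z] (f : P → Z) : Lift P → Z := WithBot.recBotCoe ⊥ f

@[simp] theorem elim_bot [PartialOrder P] [Bot Z] (f : P → Z) : elim f ⊥ = ⊥ := rfl

@[simp] theorem elim_up [Bot Z] (f : P → Z) (x : P) : elim f (up x) = f x := rfl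

theorem isLUB_up_image [PartialOrder P] {d : Set P} {a : P} (hne : d.Nonempty) (h : IsLUB d a) :
    IsLUB (up '' d) (up a) := by
  refine ⟨?_, fun b hb => ?_⟩
  · rintro _ ⟨x, hx, rfl⟩
    exact up_le_up.2 (h.1 hx)
  · obtain ⟨x, hx⟩ := hne
    obtain rfl | ⟨y, rfl⟩ := cases b
    · exact absurd (hb ⟨x, hx, rfl⟩) (not_up_le_bot x)
    · exact up_le_up.2 (h.2 fun z hz => up_le_up.1 (hb ⟨z, hz, rfl⟩))

theorem continuous_up [PartialOrder P] : ScottContinuous (up : P → Lift P) :=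
  fun _ hne _ _ ha => isLUB_up_image hne ha

theorem directedOn_preimage [PartialOrder P] {d : Set (Lift P)} (hd : DirectedOn (· ≤ ·) d) :
    DirectedOn (· ≤ ·) (up ⁻¹' d) := by
  intro x hx y hy
  obtain ⟨z, hz, h1, h2⟩ := hd _ hx _ hy
  obtain rfl | ⟨w, rfl⟩ := cases z
  · exact absurd h1 (not_up_le_bot x)
  · exact ⟨w, hz, up_le_up.1 h1, up_le_up.1 h2⟩

theorem isLUB_of_preimage [PartialOrder P] {d : Set (Lift P)} {a : P}
    (hne : (up ⁻¹' d).Nonempty) (h : IsLUB (up ⁻¹' d) a) : IsLUB d (up a) := by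
  refine ⟨fun s hs => ?_, fun b hb => (isLUB_up_image hne h).2 ?_⟩
  · obtain rfl | ⟨x, rfl⟩ := cases s
    · exact bot_le
    · exact up_le_up.2 (h.1 hs)
  · rintro _ ⟨x, hx, rfl⟩
    exact hb hx

theorem eq_bot_of_preimage [PartialOrder P] {d : Set (Lift P)} (h : ¬ (up ⁻¹' d).Nonempty)
    {s : Lift P} (hs : s ∈ d) : s = ⊥ := by
  obtain rfl | ⟨x, rfl⟩ := cases s
  · rfl
  · exact absurd ⟨x, hs⟩ h

instance [PartialOrder P] [DirComplete P] : DirComplete (Lift P) where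
  exists_isLUB d _ hd := by
    by_cases h : (up ⁻¹' d).Nonempty
    · obtain ⟨a, ha⟩ := DirComplete.exists_isLUB _ h (directedOn_preimage hd)
      exact ⟨_, isLUB_of_preimage h ha⟩
    · exact ⟨⊥, fun s hs => (eq_bot_of_preimage h hs).le, fun _ _ => bot_le⟩

noncomputable instance [PartialOrder P] [DirComplete P] : CompletePartialOrder (Lift P) :=
  DirComplete.toCompletePartialOrder _

theorem continuous_elim [PartialOrder P] [DirComplete P] [CompletePartialOrder Z] {f : P → Z}
    (hf : ScottContinuous f) : ScottContinuous (elim f) := by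
  intro d hne hd s hs
  by_cases h : (up ⁻¹' d).Nonempty
  · obtain ⟨a, ha⟩ := DirComplete.exists_isLUB _ h (directedOn_preimage hd)
    rw [hs.unique (isLUB_of_preimage h ha)]
    have := hf h (directedOn_preimage hd) ha
    refine ⟨?_, fun b hb => this.2 ?_⟩
    · rintro _ ⟨t, ht, rfl⟩
      obtain rfl | ⟨x, rfl⟩ := cases t
      · exact bot_le
      · exact this.1 ⟨x, ht, rfl⟩
    · rintro _ ⟨x, hx, rfl⟩
      exact hb ⟨_, hx, rfl⟩
  · have hd' : d = {⊥} := Set.eq_singleton_iff_nonempty_unique_mem.2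
      ⟨hne, fun s hs => eq_bot_of_preimage h hs⟩
    subst hd'
    rw [hs.unique isLUB_singleton, Set.image_singleton]
    exact isLUB_singleton

theorem continuous_elim₂ [PartialOrder P] [DirComplete P] [CompletePartialOrder E]
    [CompletePartialOrder Z] {f : E → P → Z} (hf : ∀ e, ScottContinuous (f e))
    (hf' : ∀ x, ScottContinuous fun e => f e x) :
    ScottContinuous fun p : E × Lift P => elim (f p.1) p.2 := by
  refine .fromProd (fun e => continuous_elim (hf e)) fun s => ?_
  obtain rfl | ⟨x, rfl⟩ := cases s
  · exact ScottContinuous.const ⊥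
  · exact hf' x

/-- The counit `down` of the lifting adjunction: `⊥ ↦ ⊥`, `up x ↦ x`. -/
def down [CompletePartialOrder P] : ScottHom (Lift P) P := ⟨elim id, continuous_elim .id⟩

end Lift

section Sum

variable {ι : Type} {D : ι → Type} [∀ i, CompletePartialOrder (D i)]

theorem scott_sigmaMk (i : ι) : ScottContinuous (Sigma.mk i : D i → Σ i, D i) := by
  intro d hne _ a ha
  refine ⟨?_, fun b hb => ?_⟩
  · rintro _ ⟨x, hx, rfl⟩
    exact Sigma.mk_le_mk_iff.2 (ha.1 hx)
  · obtain ⟨x, hx⟩ := hne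
    obtain ⟨j, b⟩ := b
    obtain ⟨h, -⟩ := Sigma.le_def.1 (hb ⟨x, hx, rfl⟩)
    obtain rfl : i = j := h
    exact Sigma.mk_le_mk_iff.2 (ha.2 fun z hz => Sigma.mk_le_mk_iff.1 (hb ⟨z, hz, rfl⟩))

theorem directedOn_sigma {d : Set (Σ i, D i)} (hne : d.Nonempty) (hd : DirectedOn (· ≤ ·) d) :
    ∃ i, ∃ e : Set (D i), e.Nonempty ∧ DirectedOn (· ≤ ·) e ∧ d = Sigma.mk i '' e := by
  obtain ⟨⟨i, x⟩, hx⟩ := hne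
  have h : ∀ y ∈ d, ∃ z, y = ⟨i, z⟩ := by
    rintro ⟨j, y⟩ hy
    obtain ⟨⟨k, z⟩, -, h1, h2⟩ := hd _ hx _ hy
    obtain ⟨h3, -⟩ := Sigma.le_def.1 h1
    obtain ⟨h4, -⟩ := Sigma.le_def.1 h2
    obtain rfl : i = j := h3.trans h4.symm
    exact ⟨y, rfl⟩
  refine ⟨i, Sigma.mk i ⁻¹' d, ⟨x, hx⟩, ?_, ?_⟩
  · intro y hy z hz
    obtain ⟨w, hw, h1, h2⟩ := hd _ hy _ hz
    obtain ⟨w, rfl⟩ := h w hw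
    exact ⟨w, hw, Sigma.mk_le_mk_iff.1 h1, Sigma.mk_le_mk_iff.1 h2⟩
  · ext y
    refine ⟨fun hy => ?_, ?_⟩
    · obtain ⟨z, rfl⟩ := h y hy
      exact ⟨z, hy, rfl⟩
    · rintro ⟨z, hz, rfl⟩
      exact hz

instance : DirComplete (Σ i, D i) where
  exists_isLUB d hne hd := by
    obtain ⟨i, e, hne', he, rfl⟩ := directedOn_sigma hne hd
    exact ⟨_, scott_sigmaMk i hne' he he.isLUB_sSup⟩

theorem scott_sigma {Z : Type} [Preorder Z] {f : (Σ i, D i) → Z}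
    (hf : ∀ i, ScottContinuous fun x => f ⟨i, x⟩) : ScottContinuous f := by
  intro d hne hd a ha
  obtain ⟨i, e, hne', he, rfl⟩ := directedOn_sigma hne hd
  rw [ha.unique (scott_sigmaMk i hne' he he.isLUB_sSup), Set.image_image]
  exact hf i hne' he he.isLUB_sSup

/-- The coalesced sum `⨁ i, (D i)_⊥` of the lifts of the `D i`, that is, the lifted disjoint
union: its elements are `⊥` and the `inj i x` for `x : D i`. -/
abbrev LiftedSum (D : ι → Type) : Type := Lift (Σ i, D i)

/-- The element `(i, up x)` of the sum. -/
def LiftedSum.inj (i : ι) (x : D i) : LiftedSum D := Lift.up ⟨i, x⟩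

@[fun_prop] theorem LiftedSum.continuous_inj (i : ι) :
    ScottContinuous (LiftedSum.inj (D := D) i) :=
  (scott_sigmaMk i).comp Lift.continuous_up

end Sum

/-! ### The category of pointed dcpos and strict Scott continuous functions -/

/-- A pointed dcpo. -/
structure Dom : Type 1 where
  carrier : Type
  [str : CompletePartialOrder carrier]

attribute [instance] Dom.str

instance : CoeSort Dom Type := ⟨Dom.carrier⟩

/-- Strict Scott continuous functions. -/
structure StrictHom (X Y : Type) [CompletePartialOrder X] [CompletePartialOrder Y] where
  toHom : ScottHom X Y
  map_bot' : toHom ⊥ = ⊥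

namespace StrictHom

variable {E X Y Z : Type} [CompletePartialOrder X] [CompletePartialOrder Y]
  [CompletePartialOrder Z]

instance : FunLike (StrictHom X Y) X Y where
  coe f := f.toHom
  coe_injective f g h := by
    cases f; cases g; congr; exact DFunLike.coe_injective h

@[ext] theorem ext {f g : StrictHom X Y} (h : ∀ x, f x = g x) : f = g := DFunLike.ext _ _ h

@[simp] theorem mk_apply (f : ScottHom X Y) (hf : f ⊥ = ⊥) (x : X) :
    (⟨f, hf⟩ : StrictHom X Y) x = f x := rfl

@[simp] theorem toHom_apply (f : StrictHom X Y) (x : X) : f.toHom x = f x := rfl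

@[simp] theorem map_bot (f : StrictHom X Y) : f ⊥ = ⊥ := f.map_bot'

@[fun_prop] theorem continuous (f : StrictHom X Y) : ScottContinuous f := f.toHom.scott

instance : PartialOrder (StrictHom X Y) := PartialOrder.lift (fun f x => f x) DFunLike.coe_injective

instance : OrderBot (StrictHom X Y) where
  bot := ⟨⊥, rfl⟩
  bot_le _ _ := bot_le

@[simp] theorem bot_apply (x : X) : (⊥ : StrictHom X Y) x = ⊥ := rfl

theorem isLUB_of_apply {S : Set (StrictHom X Y)} {g : StrictHom X Y}
    (h : ∀ x, IsLUB ((fun f : StrictHom X Y => f x) '' S) (g x)) : IsLUB S g :=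
  ⟨fun f hf x => (h x).1 ⟨f, hf, rfl⟩, fun k hk x => (h x).2 (by
    rintro _ ⟨f, hf, rfl⟩; exact hk hf x)⟩

theorem isLUB_apply {S : Set (StrictHom X Y)} {g : StrictHom X Y} (hS : DirectedOn (· ≤ ·) S)
    (h : IsLUB S g) (x : X) : IsLUB ((fun f : StrictHom X Y => f x) '' S) (g x) := by
  have hd : DirectedOn (· ≤ ·) (toHom '' S) := hS.mono_comp (g := toHom) (fun _ _ h => h)
  have hl := ScottHom.isLUB_dirSup _ hd
  have hb : ScottHom.dirSup _ hd ⊥ = ⊥ := by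
    refine (ScottHom.isLUB_apply hd hl ⊥).unique ⟨?_, fun _ _ => bot_le⟩
    rintro _ ⟨_, ⟨f, -, rfl⟩, rfl⟩
    exact f.map_bot.le
  have : g = ⟨ScottHom.dirSup _ hd, hb⟩ := by
    refine h.unique ⟨fun f hf => hl.1 ⟨f, hf, rfl⟩, fun k hk => ?_⟩
    have hk' : k.toHom ∈ upperBounds (toHom '' S) := by
      rintro _ ⟨f, hf, rfl⟩
      exact hk hf
    exact hl.2 hk'
  rw [this]
  have := ScottHom.isLUB_apply hd hl x
  rwa [Set.image_image] at this

theorem continuous_of_apply [Preorder E] {f : E → StrictHom X Y}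
    (h : ∀ x, ScottContinuous fun e => f e x) : ScottContinuous f :=
  fun d hne hd a ha => isLUB_of_apply fun x => by
    rw [Set.image_image]; exact h x hne hd ha

theorem continuous_apply (x : X) : ScottContinuous fun f : StrictHom X Y => f x :=
  fun _ _ hd _ ha => isLUB_apply hd ha x

end StrictHom

instance : Category Dom where
  Hom X Y := StrictHom X Y
  id X := ⟨⟨id, .id⟩, rfl⟩
  comp f g := ⟨g.toHom.comp f.toHom, by simp [ScottHom.comp]⟩

instance {X Y : Dom} : FunLike (X ⟶ Y) X Y := inferInstanceAs (FunLike (StrictHom X Y) X Y)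

instance {X Y : Dom} : PartialOrder (X ⟶ Y) := inferInstanceAs (PartialOrder (StrictHom X Y))

instance {X Y : Dom} : OrderBot (X ⟶ Y) := inferInstanceAs (OrderBot (StrictHom X Y))

@[simp] theorem Dom.id_apply {X : Dom} (x : X) : (𝟙 X : X ⟶ X) x = x := rfl

@[simp] theorem Dom.comp_apply {X Y Z : Dom} (f : X ⟶ Y) (g : Y ⟶ Z) (x : X) :
    (f ≫ g) x = g (f x) := rfl

@[ext] theorem Dom.hom_ext {X Y : Dom} {f g : X ⟶ Y} (h : ∀ x, f x = g x) : f = g :=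
  StrictHom.ext h

@[simp] theorem Dom.map_bot {X Y : Dom} (f : X ⟶ Y) : f ⊥ = ⊥ := StrictHom.map_bot f

@[simp] theorem Dom.bot_apply {X Y : Dom} (x : X) : (⊥ : X ⟶ Y) x = ⊥ := rfl

@[fun_prop] theorem Dom.continuous {X Y : Dom} (f : X ⟶ Y) : ScottContinuous f :=
  StrictHom.continuous f

theorem Dom.le_def {X Y : Dom} {f g : X ⟶ Y} : f ≤ g ↔ ∀ x, f x ≤ g x := Iff.rfl

/-- A locally continuous endofunctor of the category of pointed dcpos and strict continuous
functions. -/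
structure LCFunctor where
  functor : Dom ⥤ Dom
  continuous_map : ∀ X Y : Dom,
    ScottContinuous (functor.map : (X ⟶ Y) → (functor.obj X ⟶ functor.obj Y))

/-- The one-point domain. -/
def Dom.one : Dom := ⟨PUnit⟩

namespace LCFunctor

/-- The identity functor. -/
def identity : LCFunctor := ⟨𝟭 Dom, fun _ _ => .id⟩

/-- Constant functors. -/
def const (D : Dom) : LCFunctor :=
  ⟨(Functor.const Dom).obj D, fun _ _ => ScottContinuous.fun_const (𝟙 D)⟩

/-- The product of a family of functors. -/
def prod {ι : Type} (F : ι → LCFunctor) : LCFunctor where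
  functor :=
    { obj X := ⟨∀ i, (F i).functor.obj X⟩
      map f := ⟨⟨fun x i => (F i).functor.map f (x i),
        .pi fun i => (ScottContinuous.piApply i).comp (Dom.continuous _)⟩,
        funext fun i => Dom.map_bot _⟩
      map_id X := by
        refine StrictHom.ext fun x => funext fun i => ?_
        change (F i).functor.map (𝟙 X) (x i) = x i
        simp
      map_comp f g := by
        refine StrictHom.ext fun x => funext fun i => ?_
        change (F i).functor.map (f ≫ g) (x i) = (F i).functor.map g ((F i).functor.map f (x i))
        simp }
  continuous_map X Y := StrictHom.continuous_of_apply fun x => ScottContinuous.pi fun i =>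
    ((F i).continuous_map X Y).comp (StrictHom.continuous_apply (x i))

/-- The coalesced sum of the lifts of a family of functors. -/
noncomputable def liftedSum {ι : Type} (F : ι → LCFunctor) : LCFunctor where
  functor :=
    { obj X := ⟨LiftedSum fun i => (F i).functor.obj X⟩
      map {X Y} f := ⟨⟨Lift.elim fun s => LiftedSum.inj s.1 ((F s.1).functor.map f s.2),
        Lift.continuous_elim (scott_sigma fun i =>
          (Dom.continuous ((F i).functor.map f)).comp
            (LiftedSum.continuous_inj (D := fun i => (F i).functor.obj Y) i))⟩, rfl⟩
      map_id X := by
        refine StrictHom.ext fun s => ?_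
        obtain rfl | ⟨⟨i, x⟩, rfl⟩ := Lift.cases s
        · rfl
        · change LiftedSum.inj (D := fun i => (F i).functor.obj X) i
            ((F i).functor.map (𝟙 X) x) = LiftedSum.inj i x
          simp
      map_comp {X Y Z} f g := by
        refine StrictHom.ext fun s => ?_
        obtain rfl | ⟨⟨i, x⟩, rfl⟩ := Lift.cases s
        · rfl
        · change LiftedSum.inj (D := fun i => (F i).functor.obj Z) i
            ((F i).functor.map (f ≫ g) x) =
            LiftedSum.inj i ((F i).functor.map g ((F i).functor.map f x))
          simp }
  continuous_map X Y := StrictHom.continuous_of_apply fun s => by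
    obtain rfl | ⟨⟨i, x⟩, rfl⟩ := Lift.cases s
    · exact ScottContinuous.fun_const ⊥
    · exact (((F i).continuous_map X Y).comp (StrictHom.continuous_apply x)).comp
        (LiftedSum.continuous_inj (D := fun i => (F i).functor.obj Y) i)

end LCFunctor

/-! ### Canonical fixed points of locally continuous functors -/

namespace FIX

variable (F : LCFunctor)

/-- The finite approximations `Fⁿ(1)`. -/
def approx : ℕ → Dom
  | 0 => Dom.one
  | n + 1 => F.functor.obj (approx n)

/-- The canonical morphism `Fⁿ(1) ⟶ Fᵐ(1)`: an embedding if `n ≤ m`, a projection if `m ≤ n`. -/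
def trans : (n m : ℕ) → (approx F n ⟶ approx F m)
  | 0, _ => ⊥
  | _ + 1, 0 => ⊥
  | n + 1, m + 1 => F.functor.map (trans n m)

theorem approx_zero (x y : approx F 0) : x = y := rfl

theorem trans_zero (n : ℕ) (x : approx F n) : trans F n 0 x = ⊥ := approx_zero F _ _

theorem trans_self (n : ℕ) : trans F n n = 𝟙 _ := by
  induction n with
  | zero => rfl
  | succ n ih => rw [trans, ih]; exact F.functor.map_id _

theorem map_mono {X Y : Dom} {f g : X ⟶ Y} (h : f ≤ g) : F.functor.map f ≤ F.functor.map g :=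
  (F.continuous_map X Y).monotone h

theorem map_map {X Y Z : Dom} (f : X ⟶ Y) (g : Y ⟶ Z) (x : F.functor.obj X) :
    F.functor.map g (F.functor.map f x) = F.functor.map (f ≫ g) x := by
  rw [F.functor.map_comp]; rfl

theorem trans_trans_le (n k m : ℕ) : trans F n k ≫ trans F k m ≤ trans F n m := by
  induction n generalizing k m with
  | zero => intro x; exact (Dom.map_bot (trans F k m)).le
  | succ n ih =>
    cases k with
    | zero => intro x; exact bot_le
    | succ k =>
      cases m with
      | zero => intro x; exact bot_le
      | succ m =>
        exact (F.functor.map_comp (trans F n k) (trans F k m)).symm.le.trans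
          (map_mono F (ih k m))

theorem trans_trans (n k m : ℕ) (h : n ≤ k ∨ m ≤ k) :
    trans F n k ≫ trans F k m = trans F n m := by
  induction n generalizing k m with
  | zero => ext x; exact Dom.map_bot (trans F k m)
  | succ n ih =>
    cases m with
    | zero => ext x; exact approx_zero F _ _
    | succ m =>
      cases k with
      | zero => omega
      | succ k =>
        exact (F.functor.map_comp (trans F n k) (trans F k m)).symm.trans
          (congrArg F.functor.map (ih k m (by omega)))

/-- The underlying type of the canonical fixed point: the limit of the projections
`1 ⟵ F(1) ⟵ F²(1) ⟵ ⋯`. -/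
def Carrier : Type := {x : ∀ n, approx F n // ∀ n, trans F (n + 1) n (x (n + 1)) = x n}

instance : PartialOrder (Carrier F) := inferInstanceAs (PartialOrder (Subtype _))

instance : OrderBot (Carrier F) where
  bot := ⟨fun _ => ⊥, fun _ => Dom.map_bot _⟩
  bot_le _ _ := bot_le

theorem directedOn_coord {d : Set (Carrier F)} (hd : DirectedOn (· ≤ ·) d) (n : ℕ) :
    DirectedOn (· ≤ ·) ((fun x : Carrier F => x.1 n) '' d) :=
  hd.mono_comp (g := fun x : Carrier F => x.1 n) fun _ _ h => h n

theorem isLUB_of_coord {d : Set (Carrier F)} {a : Carrier F}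
    (h : ∀ n, IsLUB ((fun x : Carrier F => x.1 n) '' d) (a.1 n)) : IsLUB d a :=
  ⟨fun x hx n => (h n).1 ⟨x, hx, rfl⟩, fun b hb n => (h n).2 (by
    rintro _ ⟨x, hx, rfl⟩; exact hb hx n)⟩

theorem exists_isLUB_coord {d : Set (Carrier F)} (hne : d.Nonempty) (hd : DirectedOn (· ≤ ·) d) :
    ∃ a : Carrier F, ∀ n, IsLUB ((fun x : Carrier F => x.1 n) '' d) (a.1 n) := by
  have key := fun n => (directedOn_coord F hd n).isLUB_sSup
  refine ⟨⟨fun n => sSup ((fun x : Carrier F => x.1 n) '' d), fun n => ?_⟩, key⟩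
  have h := Dom.continuous (trans F (n + 1) n) (hne.image _) (directedOn_coord F hd (n + 1))
    (key (n + 1))
  rw [Set.image_image, funext fun x : Carrier F => x.2 n] at h
  exact h.unique (key n)

instance : DirComplete (Carrier F) where
  exists_isLUB _ hne hd :=
    let ⟨a, ha⟩ := exists_isLUB_coord F hne hd
    ⟨a, isLUB_of_coord F ha⟩

noncomputable instance : CompletePartialOrder (Carrier F) := DirComplete.toCompletePartialOrder _

end FIX

/-- The canonical fixed point of a locally continuous functor. -/
noncomputable def FIX (F : LCFunctor) : Dom := ⟨FIX.Carrier F⟩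

namespace FIX

variable (F : LCFunctor)

theorem scott_coord (n : ℕ) : ScottContinuous fun x : Carrier F => x.1 n := by
  intro d hne hd a ha
  obtain ⟨b, hb⟩ := exists_isLUB_coord F hne hd
  rw [ha.unique (isLUB_of_coord F hb)]
  exact hb n

/-- The projections `FIX F ⟶ Fⁿ(1)`. -/
noncomputable def proj (n : ℕ) : FIX F ⟶ approx F n :=
  ⟨⟨fun x => x.1 n, scott_coord F n⟩, rfl⟩

@[ext] theorem ext {x y : FIX F} (h : ∀ n, proj F n x = proj F n y) : x = y :=
  Subtype.ext (funext h)

/-- The morphism into `FIX F` given by a cone. -/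
noncomputable def lift {X : Dom} (f : ∀ n, X ⟶ approx F n)
    (hf : ∀ n, f (n + 1) ≫ trans F (n + 1) n = f n) : X ⟶ FIX F :=
  ⟨⟨fun x => ⟨fun n => f n x, fun n => DFunLike.congr_fun (hf n) x⟩,
    fun d hne hd a ha => isLUB_of_coord F fun n => by
      have h := Dom.continuous (f n) hne hd ha
      rwa [← Set.image_image (fun x : Carrier F => x.1 n) (fun x =>
        (⟨fun n => f n x, fun n => DFunLike.congr_fun (hf n) x⟩ : Carrier F))] at h⟩,
    Subtype.ext (funext fun n => Dom.map_bot (f n))⟩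

@[simp] theorem proj_lift {X : Dom} (f : ∀ n, X ⟶ approx F n)
    (hf : ∀ n, f (n + 1) ≫ trans F (n + 1) n = f n) (n : ℕ) (x : X) :
    proj F n (lift F f hf x) = f n x := rfl

/-- The embeddings `Fⁿ(1) ⟶ FIX F`. -/
noncomputable def emb (n : ℕ) : approx F n ⟶ FIX F :=
  lift F (trans F n) fun m => trans_trans F n (m + 1) m (.inr (by omega))

@[simp] theorem proj_emb (n m : ℕ) (x : approx F n) : proj F m (emb F n x) = trans F n m x := rfl

theorem proj_trans (n : ℕ) : proj F (n + 1) ≫ trans F (n + 1) n = proj F n := by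
  ext x; exact x.2 n

/-- `F(FIX F) ⟶ FIX F`. -/
noncomputable def fold : F.functor.obj (FIX F) ⟶ FIX F :=
  lift F (fun
    | 0 => ⊥
    | n + 1 => F.functor.map (proj F n)) (by
    rintro (_ | n)
    · rfl
    · exact (F.functor.map_comp _ _).symm.trans (congrArg F.functor.map (proj_trans F n)))

/-- The `n`th approximation of `unfold`. -/
noncomputable def unfoldApprox (n : ℕ) : FIX F ⟶ F.functor.obj (FIX F) :=
  proj F (n + 1) ≫ F.functor.map (emb F n)

theorem emb_trans_le (n : ℕ) : trans F (n + 1) n ≫ emb F n ≤ emb F (n + 1) :=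
  fun x m => trans_trans_le F (n + 1) n m x

theorem unfoldApprox_mono (x : FIX F) : Monotone fun n => unfoldApprox F n x := by
  refine monotone_nat_of_le_succ fun n => ?_
  have h1 : proj F (n + 1) x = F.functor.map (trans F (n + 1) n) (proj F (n + 2) x) :=
    (x.2 (n + 1)).symm
  have h2 : unfoldApprox F n x =
      F.functor.map (trans F (n + 1) n ≫ emb F n) (proj F (n + 2) x) :=
    (congrArg (F.functor.map (emb F n)) h1).trans (map_map F _ _ _)
  change unfoldApprox F n x ≤ F.functor.map (emb F (n + 1)) (proj F (n + 2) x)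
  rw [h2]
  exact map_mono F (emb_trans_le F n) _

/-- `FIX F ⟶ F(FIX F)`. -/
noncomputable def unfold : FIX F ⟶ F.functor.obj (FIX F) :=
  ⟨⟨fun x => ⨆ n, unfoldApprox F n x,
    .iSup_chain (fun n => Dom.continuous _) (unfoldApprox_mono F)⟩, by
    change (⨆ n, unfoldApprox F n ⊥) = ⊥
    refine IsLUB.unique (s := Set.range fun n => unfoldApprox F n ⊥)
      (unfoldApprox_mono F ⊥).directed_le.directedOn_range.isLUB_sSup ⟨?_, fun _ _ => bot_le⟩
    rintro _ ⟨n, rfl⟩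
    exact (Dom.map_bot _).le⟩

theorem isLUB_unfold (x : FIX F) :
    IsLUB (Set.range fun n => unfoldApprox F n x) (unfold F x) :=
  (unfoldApprox_mono F x).directed_le.directedOn_range.isLUB_sSup

theorem unfold_fold : unfold F ≫ fold F = 𝟙 _ := by
  ext x m
  cases m with
  | zero => exact approx_zero F _ _
  | succ m =>
    have h := Dom.continuous (fold F ≫ proj F (m + 1)) (Set.range_nonempty _)
      (unfoldApprox_mono F x).directed_le.directedOn_range (isLUB_unfold F x)
    refine h.unique ?_
    have hval : ∀ n, (fold F ≫ proj F (m + 1)) (unfoldApprox F n x)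
        = trans F (n + 1) (m + 1) (proj F (n + 1) x) := by
      intro n
      exact map_map F (emb F n) (proj F m) (proj F (n + 1) x)
    have htr : ∀ k n, n ≤ k → trans F k n (proj F k x) = proj F n x := by
      intro k n hk
      induction k, hk using Nat.le_induction with
      | base => rw [trans_self]; rfl
      | succ k hk ih =>
        rw [← trans_trans F (k + 1) k n (.inr hk), Dom.comp_apply, ← ih]
        exact congrArg _ (x.2 k)
    refine ⟨?_, fun b hb => ?_⟩
    · rintro _ ⟨_, ⟨n, rfl⟩, rfl⟩
      rw [hval]
      obtain hn | hn := le_total m n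
      · rw [htr _ _ (by omega)]; rfl
      · rw [← htr (m + 1) (n + 1) (by omega), ← Dom.comp_apply]
        refine (trans_trans_le F (m + 1) (n + 1) (m + 1) _).trans ?_
        rw [trans_self]; rfl
    · refine le_trans (le_of_eq ?_) (hb ⟨_, ⟨m, rfl⟩, rfl⟩)
      rw [hval, trans_self]; rfl

theorem emb_proj_mono : Monotone fun n => proj F n ≫ emb F n := by
  refine monotone_nat_of_le_succ fun n => ?_
  intro x
  have h : proj F n x = trans F (n + 1) n (proj F (n + 1) x) := (x.2 n).symm
  change emb F n (proj F n x) ≤ emb F (n + 1) (proj F (n + 1) x)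
  rw [h]
  exact emb_trans_le F n _

theorem isLUB_emb_proj : IsLUB (Set.range fun n => proj F n ≫ emb F n) (𝟙 (FIX F)) := by
  have hv : ∀ x : FIX F, ∀ n m, n ≤ m → proj F n (emb F m (proj F m x)) = proj F n x := by
    intro x n m h
    induction m, h using Nat.le_induction with
    | base => rw [proj_emb, trans_self]; rfl
    | succ k hk ih =>
      rw [← ih, proj_emb, proj_emb, ← trans_trans F (k + 1) k n (.inr hk), Dom.comp_apply]
      exact congrArg _ (x.2 k)
  refine ⟨?_, fun g hg x n => ?_⟩
  · rintro _ ⟨n, rfl⟩ x m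
    change proj F m (emb F n (proj F n x)) ≤ proj F m x
    rw [proj_emb]
    obtain h | h := le_total m n
    · rw [← proj_emb, hv x m n h]
    · have h1 : proj F n x = trans F m n (proj F m x) := by
        rw [← proj_emb, hv x n m h]
      rw [h1, ← Dom.comp_apply]
      refine (trans_trans_le F m n m _).trans ?_
      rw [trans_self]; rfl
  · refine le_trans (le_of_eq ?_) (hg ⟨n, rfl⟩ x n)
    exact (hv x n n le_rfl).symm

theorem fold_unfold : fold F ≫ unfold F = 𝟙 _ := by
  ext y
  have hd : DirectedOn (· ≤ ·) (Set.range fun n => proj F n ≫ emb F n) :=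
    (emb_proj_mono F).directed_le.directedOn_range
  have h := ((F.continuous_map _ _).comp (StrictHom.continuous_apply y))
    (Set.range_nonempty _) hd (isLUB_emb_proj F)
  have hy : ((fun f : StrictHom _ _ => f y) ∘ F.functor.map) (𝟙 (FIX F)) = y := by
    change F.functor.map (𝟙 (FIX F)) y = y
    rw [F.functor.map_id]; rfl
  rw [hy] at h
  refine IsLUB.unique ?_ h
  have h2 : ∀ n, unfoldApprox F n (fold F y) = F.functor.map (proj F n ≫ emb F n) y := by
    intro n
    exact map_map F _ _ _
  have := isLUB_unfold F (fold F y)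
  simp only [h2] at this
  rw [← Set.range_comp]
  exact this

/-- The canonical isomorphism `F(FIX F) ≅ FIX F`. -/
noncomputable def foldIso : F.functor.obj (FIX F) ≅ FIX F :=
  ⟨fold F, unfold F, fold_unfold F, unfold_fold F⟩

end FIX

/-! ### Session types -/

/-- The two aspects of a session type. -/
inductive Aspect
  | pos
  | neg

/-- Session types built from internal choice and recursion; all of them are positive. The index tells whether the type
variable `β` may occur free: `STy false` is the type of closed session types, and `STy true` the
type of session types with at most the free type variable `β`. -/
inductive STy : Bool → Type
  | /-- The type variable `β`. -/
    var : STy true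
  | /-- Internal choice `⊕{l : A l}`, with labels `l = 0, …, k - 1`. -/
    plus {b : Bool} {k : ℕ} (A : Fin k → STy b) : STy b
  | /-- The recursive type `ρβ.B`. -/
    mu {b : Bool} (B : STy true) : STy b

namespace STy

/-- Substitution `[C/β]A`. -/
def subst (C : STy false) : {b : Bool} → STy b → STy false
  | _, var => C
  | _, plus A => plus fun l => subst C (A l)
  | _, mu B => mu B

/-- The unfolding `[ρβ.B/β]B` of the recursive type `ρβ.B`. -/
def unfold (B : STy true) : STy false := subst (mu B) B

/-- The aspects of a session type, as locally continuous functors of the type variable. -/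
noncomputable def den (p : Aspect) : {b : Bool} → STy b → LCFunctor
  | _, var => .identity
  | _, plus A =>
    match p with
    | .pos => .liftedSum fun l => den .pos (A l)
    | .neg => .prod fun l => den .neg (A l)
  | _, mu B => .const (FIX (den p B))

/-- The domain denoted by an aspect of a closed session type. -/
noncomputable def dom (p : Aspect) (A : STy false) : Dom := (den p A).functor.obj Dom.one

theorem dom_subst (p : Aspect) (C : STy false) {b : Bool} (A : STy b) :
    dom p (subst C A) = (den p A).functor.obj (dom p C) := by
  induction A with
  | var => rfl
  | mu B => rfl
  | plus A ih =>
    cases p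
    · exact congrArg (fun D : _ → Dom => Dom.mk (LiftedSum fun l => D l)) (funext ih)
    · exact congrArg (fun D : _ → Dom => Dom.mk (∀ l, D l)) (funext ih)

/-- The isomorphism between the denotation of the unfolding of `ρβ.B` and that of `ρβ.B`: its
`hom` is `Fold` and its `inv` is `Unfold`. -/
noncomputable def foldIso (p : Aspect) (B : STy true) : dom p (unfold B) ≅ dom p (mu B) :=
  eqToIso (dom_subst p (mu B) B) ≪≫ FIX.foldIso (den p B)

/-- The denotation of a linear context. -/
noncomputable def ctx (p : Aspect) : List (STy false) → Dom
  | [] => Dom.one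
  | A :: Δ => ⟨dom p A × ctx p Δ⟩

/-- The communication `x` on the only channel of a one-channel context. -/
noncomputable def single {p : Aspect} {A : STy false} (x : dom p A) : ctx p [A] :=
  show dom p A × Dom.one from (x, ⊥)

/-- `⟦Δ ⊢ c : C⟧`: the domain of continuous functions
`⟦Δ⟧⁺ × ⟦c : C⟧⁻ → ⟦Δ⟧⁻ × ⟦c : C⟧⁺`. -/
noncomputable def judgment (Δ : List (STy false)) (C : STy false) : Dom :=
  ⟨ScottHom (ctx .pos Δ × dom .neg C) (ctx .neg Δ × dom .pos C)⟩

/-- The component of `⟦Δ₁, Δ₂⟧` in `⟦Δ₁⟧`. -/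
noncomputable def ctxLeft (p : Aspect) :
    (Δ₁ Δ₂ : List (STy false)) → ScottHom (ctx p (Δ₁ ++ Δ₂)) (ctx p Δ₁)
  | [], _ => ⟨fun _ => ⊥, .fun_const ⊥⟩
  | A :: Δ₁, Δ₂ =>
    show ScottHom (dom p A × ctx p (Δ₁ ++ Δ₂)) (dom p A × ctx p Δ₁) from
      ⟨fun d => (d.1, ctxLeft p Δ₁ Δ₂ d.2), by fun_prop⟩

/-- The component of `⟦Δ₁, Δ₂⟧` in `⟦Δ₂⟧`. -/
noncomputable def ctxRight (p : Aspect) :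
    (Δ₁ Δ₂ : List (STy false)) → ScottHom (ctx p (Δ₁ ++ Δ₂)) (ctx p Δ₂)
  | [], _ => ⟨fun d => d, .id⟩
  | A :: Δ₁, Δ₂ =>
    show ScottHom (dom p A × ctx p (Δ₁ ++ Δ₂)) (ctx p Δ₂) from
      ⟨fun d => ctxRight p Δ₁ Δ₂ d.2, by fun_prop⟩

/-- The element of `⟦Δ₁, Δ₂⟧` with given components in `⟦Δ₁⟧` and `⟦Δ₂⟧`. -/
noncomputable def ctxAppend (p : Aspect) :
    (Δ₁ Δ₂ : List (STy false)) → ScottHom (ctx p Δ₁ × ctx p Δ₂) (ctx p (Δ₁ ++ Δ₂))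
  | [], _ => ⟨fun d => d.2, .snd⟩
  | A :: Δ₁, Δ₂ =>
    show ScottHom ((dom p A × ctx p Δ₁) × ctx p Δ₂) (dom p A × ctx p (Δ₁ ++ Δ₂)) from
      ⟨fun d => (d.1.1, ctxAppend p Δ₁ Δ₂ (d.1.2, d.2)), by fun_prop⟩

end STy

/-! ### Terms and processes

The constructs of the language that occur in processes on the session types above: variables, fixed
points, quoting and spawning of processes, forwarding, composition, and transmission of labels and
unfold messages. Denotations are defined by recursion on typing derivations. -/

/-- Functional types: the type of quoted processes that use channels `Δ` and provide a channel of
type `A`. -/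
inductive FTy : Type
  | quoted (Δ : List (STy false)) (A : STy false)

/-- The denotation of a functional type. -/
noncomputable def FTy.dom : FTy → Dom
  | quoted Δ A => ⟨Lift (STy.judgment Δ A)⟩

/-- The denotation of a structural context. -/
noncomputable def FTy.ctx : List FTy → Dom
  | [] => Dom.one
  | τ :: Ψ => ⟨τ.dom × ctx Ψ⟩

/-- Variables of type `τ` in a structural context, as de Bruijn indices. -/
inductive Var : List FTy → FTy → Type
  | zero {Ψ : List FTy} {τ : FTy} : Var (τ :: Ψ) τ
  | succ {Ψ : List FTy} {τ σ : FTy} (x : Var Ψ τ) : Var (σ :: Ψ) τ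

/-- The projection `⟦Ψ⟧ → ⟦τ⟧` given by a variable. -/
noncomputable def Var.den : {Ψ : List FTy} → {τ : FTy} → Var Ψ τ → ScottHom (FTy.ctx Ψ) τ.dom
  | τ :: Ψ, _, zero => show ScottHom (τ.dom × FTy.ctx Ψ) τ.dom from ⟨Prod.fst, .fst⟩
  | σ :: Ψ, τ, succ x =>
    show ScottHom (σ.dom × FTy.ctx Ψ) τ.dom from ⟨fun u => x.den u.2, by fun_prop⟩

mutual

/-- Typing derivations `Ψ ⊩ M : τ` of functional terms. -/
inductive Term : List FTy → FTy → Type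
  | /-- A variable. -/
    var {Ψ : List FTy} {τ : FTy} (x : Var Ψ τ) : Term Ψ τ
  | /-- `fix x.M`. -/
    fix {Ψ : List FTy} {τ : FTy} (M : Term (τ :: Ψ) τ) : Term Ψ τ
  | /-- The quoted process `a ← {P} ← Δ`. -/
    quote {Ψ : List FTy} {Δ : List (STy false)} {A : STy false} (P : Proc Ψ Δ A) :
      Term Ψ (.quoted Δ A)

/-- Typing derivations `Ψ; Δ ⊢ P :: c : C` of processes. Channel names are left implicit: the used
channels are the entries of `Δ`, and `c` is the provided channel. -/
inductive Proc : List FTy → List (STy false) → STy false → Type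
  | /-- Forwarding: `Ψ; a : A ⊢ b ← a :: b : A`. -/
    fwd {Ψ : List FTy} (A : STy false) : Proc Ψ [A] A
  | /-- Composition: `Ψ; Δ₁, Δ₂ ⊢ a ← P; Q :: c : C`. -/
    cut {Ψ : List FTy} {Δ₁ Δ₂ : List (STy false)} {A C : STy false}
      (P : Proc Ψ Δ₁ A) (Q : Proc Ψ (A :: Δ₂) C) : Proc Ψ (Δ₁ ++ Δ₂) C
  | /-- Spawning a quoted process: `Ψ; Δ ⊢ a ← {M} ← Δ :: a : A`. -/
    unquote {Ψ : List FTy} {Δ : List (STy false)} {A : STy false} (M : Term Ψ (.quoted Δ A)) :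
      Proc Ψ Δ A
  | /-- Sending the label `l` on the provided channel: `Ψ; Δ ⊢ a.l; P :: a : ⊕{l : A l}`. -/
    sendLabel {Ψ : List FTy} {Δ : List (STy false)} {k : ℕ} {A : Fin k → STy false} (l : Fin k)
      (P : Proc Ψ Δ (A l)) : Proc Ψ Δ (.plus A)
  | /-- Receiving a label on a used channel:
    `Ψ; a : ⊕{l : A l}, Δ ⊢ case a {l ⇒ P l} :: c : C`. -/
    case {Ψ : List FTy} {Δ : List (STy false)} {k : ℕ} {A : Fin k → STy false} {C : STy false}
      (P : ∀ l, Proc Ψ (A l :: Δ) C) : Proc Ψ (.plus A :: Δ) C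
  | /-- Sending an unfold message on the provided channel:
    `Ψ; Δ ⊢ send a unfold; P :: a : ρβ.B`. -/
    sendUnfold {Ψ : List FTy} {Δ : List (STy false)} {B : STy true}
      (P : Proc Ψ Δ B.unfold) : Proc Ψ Δ (.mu B)
  | /-- Receiving an unfold message on a used channel:
    `Ψ; a : ρβ.B, Δ ⊢ unfold ← recv a; P :: c : C`. -/
    recvUnfold {Ψ : List FTy} {Δ : List (STy false)} {B : STy true} {C : STy false}
      (P : Proc Ψ (B.unfold :: Δ) C) : Proc Ψ (.mu B :: Δ) C

end

/-! ### Semantic clauses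

In the following clauses, `U` is the domain of environments, and a process denotes a continuous
function from `U` to the continuous functions from inputs to outputs. -/

namespace Clause

open ScottHom

variable {U X Y : Type} [CompletePartialOrder U] [CompletePartialOrder X] [CompletePartialOrder Y]
variable {Ap An Bp Bn Cp Cn Dp Dn D₁p D₁n D₂p D₂n : Type}
  [CompletePartialOrder Ap] [CompletePartialOrder An] [CompletePartialOrder Bp]
  [CompletePartialOrder Bn] [CompletePartialOrder Cp] [CompletePartialOrder Cn]
  [CompletePartialOrder Dp] [CompletePartialOrder Dn] [CompletePartialOrder D₁p]
  [CompletePartialOrder D₁n] [CompletePartialOrder D₂p] [CompletePartialOrder D₂n]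

/-- `fun u => f ∘ P u ∘ g`. -/
noncomputable def conj {X' Y' : Type} [CompletePartialOrder X'] [CompletePartialOrder Y'] (f : ScottHom Y Y')
    (g : ScottHom X' X) (P : ScottHom U (ScottHom X Y)) : ScottHom U (ScottHom X' Y') :=
  ⟨fun u => f.comp ((P u).comp g), continuous_of_apply fun x => by
    simp only [comp, mk_apply]; fun_prop⟩

/-- Forwarding: `(a⁺, b⁻) ↦ (a⁻, b⁺)` with `a⁻ = b⁻` and `b⁺ = a⁺`. -/
noncomputable def fwd : ScottHom U (ScottHom ((Ap × PUnit.{1}) × An) ((An × PUnit.{1}) × Ap)) :=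
  ⟨fun _ => ⟨fun x => ((x.2, x.1.2), x.1.1), by fun_prop⟩, .fun_const _⟩

/-- Two processes in parallel that communicate on a channel `a`; the outputs on `a⁻` and `a⁺` are
not yet fed back into the inputs. -/
def par (P : ScottHom (D₁p × An) (D₁n × Ap)) (Q : ScottHom ((Ap × D₂p) × Cn) ((An × D₂n) × Cp)) :
    ScottHom (((D₁p × D₂p) × Cn) × (An × Ap)) (((D₁n × D₂n) × Cp) × (An × Ap)) :=
  ⟨fun x =>
    let p := P (x.1.1.1, x.2.1)
    let q := Q ((x.2.2, x.1.1.2), x.1.2)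
    (((p.1, q.1.2), q.2), (q.1.1, p.2)), by fun_prop⟩

/-- Composition: the trace over `a⁻ × a⁺` of the two processes in parallel. -/
noncomputable def cut (P : ScottHom U (ScottHom (D₁p × An) (D₁n × Ap)))
    (Q : ScottHom U (ScottHom ((Ap × D₂p) × Cn) ((An × D₂n) × Cp))) :
    ScottHom U (ScottHom ((D₁p × D₂p) × Cn) ((D₁n × D₂n) × Cp)) :=
  ⟨fun u => trace (par (P u) (Q u)), by
    refine ScottContinuous.comp (continuous_of_apply fun x => ?_) continuous_trace
    simp only [par, mk_apply]; fun_prop⟩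

/-- Sending the label `l`. -/
noncomputable def sendLabel {k : ℕ} {Ap An : Fin k → Type} [∀ l, CompletePartialOrder (Ap l)]
    [∀ l, CompletePartialOrder (An l)] (l : Fin k)
    (P : ScottHom U (ScottHom (Dp × An l) (Dn × Ap l))) :
    ScottHom U (ScottHom (Dp × ∀ l, An l) (Dn × LiftedSum Ap)) :=
  ⟨fun u => ⟨fun x => ((P u (x.1, x.2 l)).1, LiftedSum.inj l (P u (x.1, x.2 l)).2), by fun_prop⟩,
    continuous_of_apply fun x => by simp only [mk_apply]; fun_prop⟩

theorem continuous_update {k : ℕ} {An : Fin k → Type} [∀ l, CompletePartialOrder (An l)]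
    (l : Fin k) : ScottContinuous (Function.update (⊥ : ∀ l, An l) l) := by
  refine ScottContinuous.pi fun i => ?_
  by_cases h : i = l
  · subst h
    simp only [Function.update_self]
    exact ScottContinuous.id
  · simp only [Function.update_of_ne h]
    exact ScottContinuous.fun_const _

section Case

variable {k : ℕ} {Ap An : Fin k → Type} [∀ l, CompletePartialOrder (Ap l)]
  [∀ l, CompletePartialOrder (An l)]
  (P : ∀ l, ScottHom U (ScottHom ((Ap l × Dp) × Cn) ((An l × Dn) × Cp)))

/-- The output of a process that has received `(l, up x)` on the channel `a`: the branch `P l` is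
run on `x`, and its output on `a⁻` is put in the component `l` of `a⁻`, the other components of
which are `⊥`. -/
noncomputable def caseBranch (z : U × (Dp × Cn)) (s : Σ l, Ap l) : ((∀ l, An l) × Dn) × Cp :=
  let r := P s.1 z.1 ((s.2, z.2.1), z.2.2)
  ((Function.update ⊥ s.1 r.1.1, r.1.2), r.2)

theorem continuous_caseBranch (l : Fin k) :
    ScottContinuous fun p : (U × (Dp × Cn)) × Ap l => caseBranch P p.1 ⟨l, p.2⟩ := by
  have h : ScottContinuous fun p : (U × (Dp × Cn)) × Ap l =>
      P l p.1.1 ((p.2, p.1.2.1), p.1.2.2) := by fun_prop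
  exact (((h.comp .fst).comp .fst).comp (continuous_update l) |>.prodMk
    ((h.comp .fst).comp .snd)).prodMk (h.comp .snd)

theorem continuous_elim_caseBranch :
    ScottContinuous fun p : (U × (Dp × Cn)) × LiftedSum Ap => Lift.elim (caseBranch P p.1) p.2 :=
  Lift.continuous_elim₂
    (fun z => scott_sigma fun l => ScottContinuous.comp (f := fun x : Ap l => (z, x))
      (by fun_prop) (continuous_caseBranch P l))
    fun s => ScottContinuous.comp (f := fun z : U × (Dp × Cn) => (z, s.2))
      (by fun_prop) (continuous_caseBranch P s.1)

/-- Receiving a label: the output is `⊥` if `a⁺ = ⊥`, and that of the branch `P l` if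
`a⁺ = (l, up x)`. -/
noncomputable def case :
    ScottHom U (ScottHom ((LiftedSum Ap × Dp) × Cn) (((∀ l, An l) × Dn) × Cp)) :=
  ⟨fun u => ⟨fun x => Lift.elim (caseBranch P (u, (x.1.2, x.2))) x.1.1,
      ScottContinuous.comp (f := fun x : (LiftedSum Ap × Dp) × Cn =>
        ((u, (x.1.2, x.2)), x.1.1)) (by fun_prop) (continuous_elim_caseBranch P)⟩,
    continuous_of_apply fun x => ScottContinuous.comp (f := fun u : U =>
        ((u, (x.1.2, x.2)), x.1.1)) (by fun_prop) (continuous_elim_caseBranch P)⟩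

end Case

end Clause

mutual

/-- `⟦Ψ ⊩ M : τ⟧ : ⟦Ψ⟧ → ⟦τ⟧`. -/
noncomputable def Term.den : {Ψ : List FTy} → {τ : FTy} → Term Ψ τ →
    ScottHom (FTy.ctx Ψ) τ.dom
  | _, _, .var x => x.den
  | Ψ, τ, .fix M =>
    dagger (A := FTy.ctx Ψ) (X := τ.dom)
      (ScottHom.comp (X := FTy.ctx Ψ × τ.dom) (Y := τ.dom × FTy.ctx Ψ) (Term.den M)
        ⟨fun p => (p.2, p.1), by fun_prop⟩)
  | _, _, .quote (Δ := Δ) (A := A) P =>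
    ScottHom.comp (Y := STy.judgment Δ A) (Z := Lift (STy.judgment Δ A))
      ⟨Lift.up, Lift.continuous_up⟩ (Proc.den P)

/-- `⟦Ψ; Δ ⊢ P :: c : C⟧ : ⟦Ψ⟧ → [⟦Δ⟧⁺ × ⟦c : C⟧⁻ → ⟦Δ⟧⁻ × ⟦c : C⟧⁺]`. -/
noncomputable def Proc.den : {Ψ : List FTy} → {Δ : List (STy false)} → {C : STy false} →
    Proc Ψ Δ C → ScottHom (FTy.ctx Ψ) (STy.judgment Δ C)
  | _, _, _, .fwd A => Clause.fwd (Ap := A.dom .pos) (An := A.dom .neg)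
  | _, _, _, .cut (Δ₁ := Δ₁) (Δ₂ := Δ₂) (A := A) (C := C) P Q =>
    Clause.conj
      (X := (STy.ctx .pos Δ₁ × STy.ctx .pos Δ₂) × C.dom .neg)
      (Y := (STy.ctx .neg Δ₁ × STy.ctx .neg Δ₂) × C.dom .pos)
      (X' := STy.ctx .pos (Δ₁ ++ Δ₂) × C.dom .neg) (Y' := STy.ctx .neg (Δ₁ ++ Δ₂) × C.dom .pos)
      ⟨fun y => (STy.ctxAppend .neg Δ₁ Δ₂ y.1, y.2), by fun_prop⟩
      ⟨fun x => ((STy.ctxLeft .pos Δ₁ Δ₂ x.1, STy.ctxRight .pos Δ₁ Δ₂ x.1), x.2), by fun_prop⟩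
      (Clause.cut (Ap := A.dom .pos) (An := A.dom .neg) (Cp := C.dom .pos) (Cn := C.dom .neg)
        (D₁p := STy.ctx .pos Δ₁) (D₁n := STy.ctx .neg Δ₁) (D₂p := STy.ctx .pos Δ₂)
        (D₂n := STy.ctx .neg Δ₂) (Proc.den P) (Proc.den Q))
  | _, _, _, .unquote (Δ := Δ) (A := A) M =>
    ScottHom.comp (Y := Lift (STy.judgment Δ A)) (Z := STy.judgment Δ A) Lift.down (Term.den M)
  | _, _, _, .sendLabel (Δ := Δ) (A := A) l P =>
    Clause.sendLabel (Ap := fun l => (A l).dom .pos) (An := fun l => (A l).dom .neg)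
      (Dp := STy.ctx .pos Δ) (Dn := STy.ctx .neg Δ) l (Proc.den P)
  | _, _, _, .case (Δ := Δ) (A := A) (C := C) P =>
    Clause.case (Ap := fun l => (A l).dom .pos) (An := fun l => (A l).dom .neg)
      (Dp := STy.ctx .pos Δ) (Dn := STy.ctx .neg Δ) (Cp := C.dom .pos) (Cn := C.dom .neg)
      fun l => Proc.den (P l)
  | _, _, _, .sendUnfold (Δ := Δ) (B := B) P =>
    Clause.conj
      (X := STy.ctx .pos Δ × STy.dom .neg B.unfold) (Y := STy.ctx .neg Δ × STy.dom .pos B.unfold)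
      (X' := STy.ctx .pos Δ × STy.dom .neg (.mu B)) (Y' := STy.ctx .neg Δ × STy.dom .pos (.mu B))
      ⟨fun y => (y.1, (STy.foldIso .pos B).hom y.2), by fun_prop⟩
      ⟨fun x => (x.1, (STy.foldIso .neg B).inv x.2), by fun_prop⟩
      (Proc.den P)
  | _, _, _, .recvUnfold (Δ := Δ) (B := B) (C := C) P =>
    Clause.conj
      (X := (STy.dom .pos B.unfold × STy.ctx .pos Δ) × C.dom .neg)
      (Y := (STy.dom .neg B.unfold × STy.ctx .neg Δ) × C.dom .pos)
      (X' := (STy.dom .pos (.mu B) × STy.ctx .pos Δ) × C.dom .neg)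
      (Y' := (STy.dom .neg (.mu B) × STy.ctx .neg Δ) × C.dom .pos)
      ⟨fun y => (((STy.foldIso .neg B).hom y.1.1, y.1.2), y.2), by fun_prop⟩
      ⟨fun x => (((STy.foldIso .pos B).inv x.1.1, x.1.2), x.2), by fun_prop⟩
      (Proc.den P)

end

/-- The output `⟦P⟧ u (δ⁺, c⁻)`, an element `(δ⁻, c⁺)` of `⟦Δ⟧⁻ × ⟦c : C⟧⁺`. -/
noncomputable def Proc.output {Ψ : List FTy} {Δ : List (STy false)} {C : STy false}
    (P : Proc Ψ Δ C) (u : FTy.ctx Ψ) (x : STy.ctx .pos Δ × STy.dom .neg C) :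
    STy.ctx .neg Δ × STy.dom .pos C :=
  (show ScottHom (STy.ctx .pos Δ × STy.dom .neg C) (STy.ctx .neg Δ × STy.dom .pos C) from P.den u) x

/-- Semantic equivalence of processes. -/
def Proc.Equiv {Ψ : List FTy} {Δ : List (STy false)} {C : STy false} (P Q : Proc Ψ Δ C) : Prop :=
  P.den = Q.den

/-! ### Flipping bit streams -/

/-- `bits = ρβ.⊕{0 : β, 1 : β}`. -/
def bits : STy false := .mu (.plus (k := 2) fun _ => .var)

/-- The complement of a label: `0 ↦ 1`, `1 ↦ 0`. -/
def complement (l : Fin 2) : Fin 2 := 1 - l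

/-- The quoted bit-flipping process
`fix F. f ← {send f unfold; unfold ← recv b; case b {l ⇒ f.(complement l); f ← {F} ← b}} ← b`. -/
def flip : Term [] (.quoted [bits] bits) :=
  .fix <| .quote <| .sendUnfold <| .recvUnfold <| .case fun l =>
    .sendLabel (complement l) <| .unquote <| .var .zero

/-- The composition `a : bits ⊢ t ← {flip} ← a; b ← {flip} ← t :: b : bits`. -/
def flipTwice : Proc [] [bits] bits := .cut (.unquote flip) (.unquote flip)

end SILL

namespace SILL

-- The negative aspect of `bits` is a one-point domain: its functor is `X ↦ X × X`, whose
-- approximations starting from the one-point domain are all one-point. Hence nothing is ever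
-- communicated from client to provider, and a process that uses and provides `bits` amounts to a
-- function on the positive aspect, the domain of finite partial and infinite bit streams.
--
-- Let `φ` be the stream function of `flip` (`streamFun flipDen`). Unrolling the fixed point once
-- gives `φ ⊥ = ⊥` and `φ (l · x) = l̃ · φ x`. In the composition, the feedback equation says that
-- the stream on the intermediate channel is `φ x`, computed from the input `x` alone, so the output
-- is `φ (φ x)`.
--
-- It remains to see that `φ ∘ φ` is the identity. A stream is determined by its projections to the
-- finite approximations `Fⁿ(1)`, and the projection of `l · w` at depth `n + 1` depends only on `l`
-- and on the projection of `w` at depth `n`. Induction on the depth then concludes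
-- (`streamFun_flipDen_streamFun_flipDen`).
--
-- Only the fixed point equations are used, for `flip` as well as for the trace. Leastness plays no
-- role: the recursion of `flip` is guarded by an emitted bit, and the feedback is not circular once
-- the negative aspect is trivial.

-- Fixed point equations for `fix`, `dagger` and `trace`

theorem fix_eq {D : Type} [CompletePartialOrder D] (f : ScottHom D D) : fix f = f (fix f) := by
  have hm := f.monotone_iterate
  have h : IsLUB (Set.range fun n => f^[n] ⊥) (fix f) :=
    hm.directed_le.directedOn_range.isLUB_sSup
  have h' := f.scott (Set.range_nonempty _) hm.directed_le.directedOn_range h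
  -- By continuity `f (fix f)` is the least upper bound of the shifted chain `fⁿ⁺¹(⊥)`, which has
  -- the same upper bounds as the chain `fⁿ(⊥)` itself.
  refine h.unique ⟨?_, fun b hb => h'.2 ?_⟩
  · rintro _ ⟨n, rfl⟩
    refine (hm n.le_succ).trans (h'.1 ⟨_, ⟨n, rfl⟩, ?_⟩)
    exact (Function.iterate_succ_apply' f n ⊥).symm
  · rintro _ ⟨_, ⟨n, rfl⟩, rfl⟩
    exact hb ⟨n + 1, Function.iterate_succ_apply' f n ⊥⟩

theorem dagger_eq {A X : Type} [CompletePartialOrder A] [CompletePartialOrder X]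
    (f : ScottHom (A × X) X) (a : A) : dagger f a = f (a, dagger f a) :=
  fix_eq (f.curry a)

/-- The trace is computed by some solution of the feedback equation. -/
theorem exists_trace_eq {A B X : Type} [CompletePartialOrder A] [CompletePartialOrder B]
    [CompletePartialOrder X] (f : ScottHom (A × X) (B × X)) (a : A) :
    ∃ x, x = (f (a, x)).2 ∧ trace f a = (f (a, x)).1 :=
  ⟨_, dagger_eq _ a, rfl⟩

-- The two domains denoted by `bits`

/-- The functors of the body of the recursive type `bits`. -/
noncomputable abbrev bitsFunctor (p : Aspect) : LCFunctor :=
  STy.den p (.plus (k := 2) fun _ => .var)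

theorem subsingleton_approx_neg (n : ℕ) : Subsingleton (FIX.approx (bitsFunctor .neg) n) := by
  induction n with
  | zero => exact ⟨fun _ _ => rfl⟩
  | succ n ih =>
    exact ⟨fun x y => funext fun _ : Fin 2 => ih.elim _ _⟩

/-- A point of the canonical fixed point is determined by its projections, and these lie in
one-point domains. This is what allows negative inputs and outputs to be ignored everywhere below.
-/
instance subsingleton_bits_neg : Subsingleton (STy.dom .neg bits) :=
  ⟨fun x y => FIX.ext (bitsFunctor .neg) (x := x) (y := y)
    fun n => (subsingleton_approx_neg n).elim _ _⟩

/-- The stream that starts with the bit `l` and continues as `x`. -/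
noncomputable def bitsCons (l : Fin 2) (x : STy.dom .pos bits) : STy.dom .pos bits :=
  FIX.fold (bitsFunctor .pos)
    (LiftedSum.inj (D := fun _ : Fin 2 => (STy.dom .pos bits : Type)) l x)

/-- Since `x` is the fold of its unfolding, a case distinction in the lifted sum transfers to
streams; strictness of `fold` takes care of `⊥`. -/
theorem bits_cases (x : STy.dom .pos bits) : x = ⊥ ∨ ∃ l y, x = bitsCons l y := by
  have h : FIX.fold (bitsFunctor .pos) (FIX.unfold (bitsFunctor .pos) x) = x :=
    DFunLike.congr_fun (FIX.unfold_fold (bitsFunctor .pos)) x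
  obtain h0 | ⟨⟨l, y⟩, h0⟩ := Lift.cases (FIX.unfold (bitsFunctor .pos) x)
  · left; rw [← h, h0]; exact Dom.map_bot _
  · right; exact ⟨l, y, by rw [← h, h0]; rfl⟩

/-- The guardedness behind the final induction: prefixing a bit costs one level of approximation. It
holds by definition, because `fold` acts at level `n + 1` as the functor applied to the projection
at level `n`. -/
theorem proj_bitsCons (n : ℕ) (l : Fin 2) (x : STy.dom .pos bits) :
    FIX.proj (bitsFunctor .pos) (n + 1) (bitsCons l x) =
      LiftedSum.inj (D := fun _ : Fin 2 => (FIX.approx (bitsFunctor .pos) n : Type)) l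
        (FIX.proj (bitsFunctor .pos) n x) := rfl

/-- `STy.foldIso` contains a transport along `STy.dom_subst`. For the body of `bits` the two domains
agree definitionally, so by proof irrelevance the equality is `rfl` and the transport is the
identity. -/
theorem foldIso_pos_hom :
    (STy.foldIso .pos (.plus (k := 2) fun _ => .var)).hom = FIX.fold (bitsFunctor .pos) := by
  have h : STy.dom_subst .pos bits (.plus (k := 2) fun _ => .var) =
      (rfl : (bitsFunctor .pos).functor.obj (STy.dom .pos bits) = _) := rfl
  change eqToHom (STy.dom_subst .pos bits (.plus (k := 2) fun _ => .var)) ≫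
    FIX.fold (bitsFunctor .pos) = _
  rw [h]; exact Category.id_comp _

theorem foldIso_pos_inv :
    (STy.foldIso .pos (.plus (k := 2) fun _ => .var)).inv = FIX.unfold (bitsFunctor .pos) := by
  have h : (STy.dom_subst .pos bits (.plus (k := 2) fun _ => .var)).symm =
      (rfl : (bitsFunctor .pos).functor.obj (STy.dom .pos bits) = _) := rfl
  change FIX.unfold (bitsFunctor .pos) ≫
    eqToHom (STy.dom_subst .pos bits (.plus (k := 2) fun _ => .var)).symm = _
  rw [h]; exact Category.comp_id _

-- The stream function of `flip`

/-- The equation of `dagger`, after the swap in `Term.den` that makes the fixed point the newest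
entry of the environment, that is, variable zero. -/
theorem Term.den_fix {Ψ : List FTy} {τ : FTy} (M : Term (τ :: Ψ) τ) (u : FTy.ctx Ψ) :
    Term.den (.fix M) u =
      (show ScottHom (τ.dom × FTy.ctx Ψ) τ.dom from Term.den M) (Term.den (.fix M) u, u) := by
  rw [Term.den]
  exact dagger_eq _ _

/-- The output on the provided channel of a process that uses and provides a stream of bits. -/
noncomputable def streamFun (f : STy.judgment [bits] bits) (x : STy.dom .pos bits)
    (y : STy.dom .neg bits) : STy.dom .pos bits :=
  ((show ScottHom (STy.ctx .pos [bits] × STy.dom .neg bits)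
    (STy.ctx .neg [bits] × STy.dom .pos bits) from f) (STy.single x, y)).2

/-- The denotation of the process that `flip` quotes. -/
noncomputable def flipDen : STy.judgment [bits] bits :=
  Proc.den (.unquote flip) (⊥ : FTy.ctx [])

/-- The body of the process that `flip` quotes. -/
def flipBody : Proc [.quoted [bits] bits] [bits] bits :=
  .sendUnfold <| .recvUnfold <| .case fun l =>
    .sendLabel (complement l) <| .unquote <| .var .zero

/-- One unrolling of the fixed point: `flip` denotes `up` of its body, run in the environment where
`F` is `flip` itself, and `down` cancels this `up`. -/
theorem flipDen_eq :
    flipDen = Proc.den flipBody (Term.den flip (⊥ : FTy.ctx []), (⊥ : FTy.ctx [])) := by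
  have h := Term.den_fix (.quote flipBody) (⊥ : FTy.ctx [])
  rw [flipDen, Proc.den]
  refine (congrArg (Lift.down (P := STy.judgment [bits] bits)) h).trans ?_
  rw [Term.den]
  rfl

/-- The semantic clauses of the body compose to: unfold the input, branch on its first bit, emit the
complement, recurse on the tail, fold the result. Spawning `F` in the environment of `flipDen_eq`
gives `flipDen` again. -/
theorem streamFun_flipDen (x : STy.dom .pos bits) (z : STy.dom .neg bits) :
    streamFun flipDen x z = FIX.fold (bitsFunctor .pos)
      (Lift.elim (fun s : Σ _ : Fin 2, (STy.dom .pos bits : Type) =>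
        LiftedSum.inj (D := fun _ : Fin 2 => (STy.dom .pos bits : Type)) (complement s.1)
          (streamFun flipDen s.2 ⊥)) (FIX.unfold (bitsFunctor .pos) x)) := by
  -- Only the outer call is unrolled; the recursive call on the right must stay folded.
  conv_lhs => rw [flipDen_eq]
  rw [← foldIso_pos_hom, ← foldIso_pos_inv]
  simp only [flipBody, Proc.den, streamFun]
  refine congrArg (STy.foldIso .pos (.plus (k := 2) fun _ => .var)).hom ?_
  change (Lift.elim (Clause.caseBranch (Ap := fun _ : Fin 2 => STy.dom .pos bits)
    (An := fun _ : Fin 2 => STy.dom .neg bits)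
    (Dp := STy.ctx .pos []) (Dn := STy.ctx .neg [])
    (Cp := LiftedSum fun _ : Fin 2 => (STy.dom .pos bits : Type))
    (Cn := Fin 2 → STy.dom .neg bits) _ _)
    ((STy.foldIso .pos (.plus (k := 2) fun _ => .var)).inv x)).2 = _
  generalize (STy.foldIso .pos (.plus (k := 2) fun _ => .var)).inv x = s
  obtain rfl | ⟨⟨l, y⟩, rfl⟩ := Lift.cases s
  · rfl
  · refine congrArg (LiftedSum.inj (D := fun _ : Fin 2 => (STy.dom .pos bits : Type))
      (complement l)) ?_
    -- The recursive call receives a component of the unfolding of `z` as its negative input; it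
    -- equals `⊥` because the domain has one point.
    exact congrArg (streamFun flipDen y) (subsingleton_bits_neg.elim _ _)

/-- `Unfold`, `Lift.elim` and `Fold` are all strict. In particular the unfold message that `flip`
sends before reading anything leaves no trace in the output. -/
theorem streamFun_flipDen_bot (z : STy.dom .neg bits) : streamFun flipDen ⊥ z = ⊥ := by
  rw [streamFun_flipDen]
  refine (congrArg (fun s => FIX.fold (bitsFunctor .pos) (Lift.elim _ s))
    (Dom.map_bot (FIX.unfold (bitsFunctor .pos)))).trans ?_
  exact Dom.map_bot (FIX.fold (bitsFunctor .pos))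

theorem unfold_bitsCons (l : Fin 2) (x : STy.dom .pos bits) :
    FIX.unfold (bitsFunctor .pos) (bitsCons l x) =
      LiftedSum.inj (D := fun _ : Fin 2 => (STy.dom .pos bits : Type)) l x :=
  DFunLike.congr_fun (FIX.fold_unfold (bitsFunctor .pos)) _

/-- One bit read, one bit emitted: with the strict case, this is all that the final induction needs
to know about `flip`. -/
theorem streamFun_flipDen_bitsCons (l : Fin 2) (x : STy.dom .pos bits) (z : STy.dom .neg bits) :
    streamFun flipDen (bitsCons l x) z = bitsCons (complement l) (streamFun flipDen x ⊥) := by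
  rw [streamFun_flipDen, unfold_bitsCons]
  rfl

theorem complement_complement (l : Fin 2) : complement (complement l) = l :=
  sub_sub_cancel 1 l

/-- Flipping every bit of a stream twice gives back the stream. -/
theorem streamFun_flipDen_streamFun_flipDen (x : STy.dom .pos bits) (y z : STy.dom .neg bits) :
    streamFun flipDen (streamFun flipDen x y) z = x := by
  refine FIX.ext (bitsFunctor .pos) fun n => ?_
  -- The hypothesis is applied to the tail `w` with both negative inputs equal to `⊥`, so all three
  -- variables must vary.
  induction n generalizing x y z with
  | zero => exact FIX.approx_zero _ _ _
  | succ n ih =>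
    obtain rfl | ⟨l, w, rfl⟩ := bits_cases x
    · rw [streamFun_flipDen_bot, streamFun_flipDen_bot]
    · rw [streamFun_flipDen_bitsCons, streamFun_flipDen_bitsCons, complement_complement,
        proj_bitsCons, proj_bitsCons, ih]

-- Tracing the composite and comparing with the forwarder

/-- Outputs on the used channel carry no information, so two processes of this type need only be
compared on the provided channel. -/
instance subsingleton_ctx_neg : Subsingleton (STy.ctx .neg [bits]) :=
  ⟨fun x y => Prod.ext (subsingleton_bits_neg.elim (Prod.fst x) (Prod.fst y)) rfl⟩

/-- The two copies of `flip` in `flipTwice`, before their outputs are fed back. -/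
noncomputable def flipPar :
    ScottHom (((STy.ctx .pos [bits] × STy.ctx .pos []) × STy.dom .neg bits) ×
        (STy.dom .neg bits × STy.dom .pos bits))
      (((STy.ctx .neg [bits] × STy.ctx .neg []) × STy.dom .pos bits) ×
        (STy.dom .neg bits × STy.dom .pos bits)) :=
  Clause.par (Ap := STy.dom .pos bits) (An := STy.dom .neg bits) (Cp := STy.dom .pos bits)
    (Cn := STy.dom .neg bits) (D₁p := STy.ctx .pos [bits]) (D₁n := STy.ctx .neg [bits])
    (D₂p := STy.ctx .pos []) (D₂n := STy.ctx .neg []) flipDen flipDen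

/-- `flipTwice` copies its input to its output. -/
theorem flipTwice_output (u : FTy.ctx []) (x : STy.dom .pos bits) (z : STy.dom .neg bits) :
    Proc.output flipTwice u (STy.single x, z) = (STy.single ⊥, x) := by
  refine Prod.ext (subsingleton_ctx_neg.elim _ _) ?_
  rw [Proc.output, flipTwice, Proc.den]
  obtain rfl : u = (⊥ : FTy.ctx []) := rfl
  -- `p = (t⁻, t⁺)` is the traffic on the intermediate channel. That it solves the feedback equation
  -- is enough, since its positive part depends only on `x` and on the trivial `t⁻`.
  obtain ⟨p, hp, h⟩ := exists_trace_eq flipPar ((STy.single x, (⊥ : STy.ctx .pos [])), z)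
  have hp2 : p.2 = streamFun flipDen x p.1 := congrArg Prod.snd hp
  have h2 := congrArg Prod.snd h
  -- With `Δ₁ = [bits]` and `Δ₂ = []`, splitting the input context computes to `STy.single x` and
  -- the empty context, and gluing the negative outputs does not touch the provided channel; hence
  -- `h2` matches the goal definitionally.
  refine Eq.trans
    (b := (flipPar (((STy.single x, (⊥ : STy.ctx .pos [])), z), p)).1.2) h2 ?_
  change streamFun flipDen p.2 z = x
  rw [hp2, streamFun_flipDen_streamFun_flipDen]

end SILL

theorem mainTheorem12 :
    SILL.Proc.Equiv SILL.flipTwice (SILL.Proc.fwd SILL.bits) ∧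
    ∀ a : SILL.STy.dom .pos SILL.bits,
      SILL.Proc.output SILL.flipTwice ⊥ (SILL.STy.single a, ⊥) =
        (SILL.STy.single ⊥, a) := by
  refine ⟨?_, fun a => SILL.flipTwice_output _ a _⟩
  refine SILL.ScottHom.ext fun u => ?_
  refine SILL.ScottHom.ext (X := SILL.STy.ctx .pos [SILL.bits] × SILL.STy.dom .neg SILL.bits)
    (Y := SILL.STy.ctx .neg [SILL.bits] × SILL.STy.dom .pos SILL.bits) fun ⟨d, z⟩ => ?_
  -- By eta for pairs and for `PUnit`, `d` is `STy.single` of its first component.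
  refine (SILL.flipTwice_output u (Prod.fst d) z).trans ?_
  rw [SILL.Proc.den]
  -- On the used channel the forwarder returns `z` where the composite returns `⊥`; the two coincide
  -- in a one-point domain.
  exact Prod.ext (SILL.subsingleton_ctx_neg.elim _ _) rfl
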